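/- Let $N\ge1$ and $M\ge0$ be integers, let $k_1<\dots<k_M$ be integers with $0<k_j<N$, and put $\Lambda=\{0,\dots,N\}\setminus\{k_1,\dots,k_M\}$. Let $\mathcal P(\Lambda)$ be the complex space of polynomials $\sum_{k\in\Lambda}c_kz^k$, viewed as a subspace of $L^1(\mathbb T)$ with the norm $\|f\|_1=\frac1{2\pi}\int_{\mathbb T}|f(\zeta)|\,|d\zeta|$, where $\mathbb T$ is the unit circle, and let $\mathrm{ball}(\mathcal P(\Lambda))$ be its closed unit ball. A point $\xi$ of the closed unit ball of a complex normed space $X$ is called exposed if there is a functional $\phi\in X^*$ with $\|\phi\|=1$ and $\{x\in X:\|x\|\le1,\ \phi(x)=1\}=\{\xi\}$. Let $p\in\mathcal P(\Lambda)$ with $\|p\|_1=1$, say $p(z)=\sum_{k=0}^Nc_kz^k$, and let $p^*(z)=\sum_{k=0}^N\overline{c_k}z^{N-k}$. Let $a_1,\dots,a_n$ be the distinct common zeros of $p$ and $p^*$ in the open unit disk, let $m_j$ be the minimum of the multiplicities of $a_j$ as a zero of $p$ and of $p^*$, and put $m=\sum_jm_j$. Let $\zeta_1,\dots,\zeta_\nu$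 be the distinct zeros of $p$ on $\mathbb T$, with multiplicities $\lambda_1,\dots,\lambda_\nu$, and put $\mu_j=\lfloor\lambda_j/2\rfloor$, $\mu=\sum_j\mu_j$ and $\widetilde m=m+\mu$. The polynomial $$\widetilde G(z)=\prod_{j=1}^n(z-a_j)^{m_j}(1-\overline{a_j}z)^{m_j}\prod_{j=1}^\nu(z-\zeta_j)^{\mu_j}(1-\overline{\zeta_j}z)^{\mu_j}$$ divides $p$; write $p/\widetilde G=\widetilde R=\sum_k\widetilde C_kz^k$, with $\widetilde C_k=0$ for all $k\in\mathbb Z$ outside $[0,\deg\widetilde R]$, and put $\widetilde A(k)=\operatorname{Re}\widetilde C_k$, $\widetilde B(k)=\operatorname{Im}\widetilde C_k$. For $1\le j\le M$ let $$\widetilde A^{\pm}_{j,l}=\widetilde A(k_j+l-\widetilde m)\pm\widetilde A(k_j-l-\widetilde m),\qquad \widetilde B^{\pm}_{j,l}=\widetilde B(k_j+l-\widetilde m)\pm\widetilde B(k_j-l-\widetilde m),$$ and form the real $2M\times(2\widetilde m+1)$ block matrix $$\widetilde{\mathfrak M}=\begin{pmatrix}\widetilde{\mathcal A}^+&\widetilde{\mathcal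 B}^-\\ \widetilde{\mathcal B}^+&-\widetilde{\mathcal A}^-\end{pmatrix},$$ where $\widetilde{\mathcal A}^+=(\widetilde A^+_{j,l})$ and $\widetilde{\mathcal B}^+=(\widetilde B^+_{j,l})$ have columns $l=0,\dots,\widetilde m$, while $\widetilde{\mathcal A}^-=(\widetilde A^-_{j,l})$ and $\widetilde{\mathcal B}^-=(\widetilde B^-_{j,l})$ have columns $l=1,\dots,\widetilde m$. If $\operatorname{rank}\widetilde{\mathfrak M}=2\widetilde m$, then $p$ is an exposed point of $\mathrm{ball}(\mathcal P(\Lambda))$. -/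

import Mathlib

open Polynomial MeasureTheory

noncomputable section

namespace Fewnomial

instance fact_two_pi_pos : Fact (0 < 2 * Real.pi) := ⟨Real.two_pi_pos⟩

/-- The Banach space `L¹` of the unit circle with its normalized arc length measure; the circle is
parametrized by the angle modulo `2π`, the angle `t` corresponding to the point `e^{it}`. -/
abbrev L1 : Type :=
  Lp ℂ 1 (AddCircle.haarAddCircle (T := 2 * Real.pi))

/-- The restriction of a polynomial to the unit circle, as a continuous function of the angle. -/
def onCircle : ℂ[X] →ₗ[ℂ] C(AddCircle (2 * Real.pi), ℂ) where
  toFun p := ⟨fun t => p.eval (AddCircle.toCircle t : ℂ),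
    p.continuous.comp (continuous_subtype_val.comp AddCircle.continuous_toCircle)⟩
  map_add' p q := by ext t; simp
  map_smul' c p := by ext t; simp

/-- The embedding of the polynomials into `L¹` of the circle. -/
def toL1 : ℂ[X] →ₗ[ℂ] L1 :=
  (ContinuousMap.toLp 1 AddCircle.haarAddCircle ℂ).toLinearMap ∘ₗ onCircle

/-- The set `Λ = {0, …, N} \ {k₁, …, k_M}` of admissible exponents. -/
def admissible (N : ℕ) {M : ℕ} (k : Fin M → ℕ) : Finset ℕ :=
  Finset.range (N + 1) \ Finset.univ.image k

/-- The space of polynomials `∑_{n ∈ Λ} cₙ zⁿ` with complex coefficients. -/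
def lacunary (Λ : Finset ℕ) : Submodule ℂ ℂ[X] where
  carrier := {p | ∀ n ∉ Λ, p.coeff n = 0}
  add_mem' hp hq n hn := by simp [hp n hn, hq n hn]
  zero_mem' n _ := by simp
  smul_mem' c p hp n hn := by simp [hp n hn]

/-- The space `𝒫(Λ)`, viewed as a subspace of `L¹`, with the norm inherited from there. -/
def lacunaryL1 (Λ : Finset ℕ) : Submodule ℂ L1 :=
  (lacunary Λ).map toL1

/-- A point `ξ` of the closed unit ball of `X` is exposed if some functional of norm `1` takes
the value `1` at `ξ` and at no other point of the ball. -/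
def IsExposedPointOfBall {X : Type*} [NormedAddCommGroup X] [NormedSpace ℂ X] (ξ : X) : Prop :=
  ξ ∈ Metric.closedBall (0 : X) 1 ∧
    ∃ φ : X →L[ℂ] ℂ, ‖φ‖ = 1 ∧ {x ∈ Metric.closedBall (0 : X) 1 | φ x = 1} = {ξ}

/-- `p*(z) = z^N · conj (p (1 / conj z))`, that is, `∑ conj(cₙ) z^(N-n)` for `p = ∑ cₙ zⁿ` of degree
at most `N`. -/
def pstar (N : ℕ) (p : ℂ[X]) : ℂ[X] :=
  ∑ n ∈ Finset.range (N + 1), C (starRingEnd ℂ (p.coeff n)) * X ^ (N - n)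

/-- The common zeros `a_j` of `p` and `p*` in the open unit disk. -/
def diskZeros (N : ℕ) (p : ℂ[X]) : Finset ℂ :=
  {a ∈ p.roots.toFinset ∩ (pstar N p).roots.toFinset | ‖a‖ < 1}

/-- The multiplicity `m_j` of the common zero `a = a_j`. -/
def diskMult (N : ℕ) (p : ℂ[X]) (a : ℂ) : ℕ :=
  min (p.rootMultiplicity a) ((pstar N p).rootMultiplicity a)

/-- The zeros `ζ_j` of `p` on the unit circle. -/
def circleZeros (p : ℂ[X]) : Finset ℂ :=
  {ζ ∈ p.roots.toFinset | ‖ζ‖ = 1}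

/-- The number `μ_j = [λ_j / 2]`, with `λ_j` the multiplicity of the zero `ζ = ζ_j`. -/
def circleMult (p : ℂ[X]) (ζ : ℂ) : ℕ :=
  p.rootMultiplicity ζ / 2

/-- `m̃ = m + μ`, where `m = ∑ m_j` and `μ = ∑ μ_j`. -/
def mTilde (N : ℕ) (p : ℂ[X]) : ℕ :=
  ∑ a ∈ diskZeros N p, diskMult N p a + ∑ ζ ∈ circleZeros p, circleMult p ζ

/-- `G(z) = ∏ (z - a_j)^{m_j} (1 - conj(a_j) z)^{m_j}`. -/
def G (N : ℕ) (p : ℂ[X]) : ℂ[X] :=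
  ∏ a ∈ diskZeros N p,
    (X - C a) ^ diskMult N p a * (1 - C (starRingEnd ℂ a) * X) ^ diskMult N p a

/-- `G₀(z) = ∏ (z - ζ_j)^{μ_j} (1 - conj(ζ_j) z)^{μ_j}`. -/
def G₀ (p : ℂ[X]) : ℂ[X] :=
  ∏ ζ ∈ circleZeros p,
    (X - C ζ) ^ circleMult p ζ * (1 - C (starRingEnd ℂ ζ) * X) ^ circleMult p ζ

/-- `G̃ = G G₀`. -/
def GTilde (N : ℕ) (p : ℂ[X]) : ℂ[X] := G N p * G₀ p

/-- The polynomial `R̃ = p / G̃` (`G̃` divides `p`, so that the division is exact). -/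
def RTilde (N : ℕ) (p : ℂ[X]) : ℂ[X] := p / GTilde N p

/-- The coefficients `C̃_r` of `R̃` for `r ∈ ℤ`; they vanish for `r < 0`. -/
def CTilde (N : ℕ) (p : ℂ[X]) (r : ℤ) : ℂ :=
  if 0 ≤ r then (RTilde N p).coeff r.toNat else 0

def ATilde (N : ℕ) (p : ℂ[X]) (r : ℤ) : ℝ := (CTilde N p r).re

def BTilde (N : ℕ) (p : ℂ[X]) (r : ℤ) : ℝ := (CTilde N p r).im

section Blocks

variable (N : ℕ) {M : ℕ} (k : Fin M → ℕ) (p : ℂ[X])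

/-- The block with entries `Ã(k_j + l - m̃) + Ã(k_j - l - m̃)`, `0 ≤ l ≤ m̃`. -/
def APlus : Matrix (Fin M) (Fin (mTilde N p + 1)) ℝ := Matrix.of fun j l =>
  ATilde N p ((k j : ℤ) + (l : ℕ) - mTilde N p) + ATilde N p ((k j : ℤ) - (l : ℕ) - mTilde N p)

/-- The block with entries `B̃(k_j + l - m̃) + B̃(k_j - l - m̃)`, `0 ≤ l ≤ m̃`. -/
def BPlus : Matrix (Fin M) (Fin (mTilde N p + 1)) ℝ := Matrix.of fun j l =>
  BTilde N p ((k j : ℤ) + (l : ℕ) - mTilde N p) + BTilde N p ((k j : ℤ) - (l : ℕ) - mTilde N p)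

/-- The block with entries `Ã(k_j + l - m̃) - Ã(k_j - l - m̃)`, `1 ≤ l ≤ m̃`; the column with
index `i : Fin m̃` belongs to `l = i + 1`. -/
def AMinus : Matrix (Fin M) (Fin (mTilde N p)) ℝ := Matrix.of fun j i =>
  ATilde N p ((k j : ℤ) + ((i : ℕ) + 1) - mTilde N p) -
    ATilde N p ((k j : ℤ) - ((i : ℕ) + 1) - mTilde N p)

/-- The block with entries `B̃(k_j + l - m̃) - B̃(k_j - l - m̃)`, `1 ≤ l ≤ m̃`; the column with
index `i : Fin m̃` belongs to `l = i + 1`. -/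
def BMinus : Matrix (Fin M) (Fin (mTilde N p)) ℝ := Matrix.of fun j i =>
  BTilde N p ((k j : ℤ) + ((i : ℕ) + 1) - mTilde N p) -
    BTilde N p ((k j : ℤ) - ((i : ℕ) + 1) - mTilde N p)

/-- The real `2M × (2m̃ + 1)` matrix with the blocks `Ã⁺, B̃⁻` (top) and `B̃⁺, -Ã⁻` (bottom). -/
def MTilde : Matrix (Fin M ⊕ Fin M) (Fin (mTilde N p + 1) ⊕ Fin (mTilde N p)) ℝ :=
  Matrix.fromBlocks (APlus N k p) (BMinus N k p) (BPlus N k p) (-AMinus N k p)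

end Blocks

end Fewnomial

end

/-!
The functional `q ↦ ∫ q p̄ / |p|` has norm one, and it attains its norm at `q` only if `q p̄ ≥ 0`
on the circle. So `p` is exposed as soon as every such `q ∈ 𝒫(Λ)` is a multiple of `p`. For such a
`q`, the quotient `q / p` is real on the circle, i.e. `q p* = q* p`, and the orders of `q` and `p`
at each point of the circle have the same parity. Comparing multiplicities gives `q = S R̃`, where
`S` is self-inversive of degree `2 m̃`, just as `p = G̃ R̃`. The vanishing of the coefficients at
the `k_j` says that the real coordinate vector of `S` lies in the kernel of the matrix. By the
rank condition this kernel is a line, and it contains the coordinate vector of `G̃`, so `S` is a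
real multiple of `G̃`.
-/

noncomputable section

open scoped ComplexOrder ComplexConjugate ENNReal

namespace Fewnomial

section Reversal

variable {N m n : ℕ} {f g : ℂ[X]}

theorem coeff_pstar (N : ℕ) (f : ℂ[X]) (i : ℕ) :
    (pstar N f).coeff i = if i ≤ N then conj (f.coeff (N - i)) else 0 := by
  rw [pstar, ← Finset.sum_range_reflect, finsetSum_coeff]
  have hterm : ∀ j ∈ Finset.range (N + 1),
      (C (conj (f.coeff (N + 1 - 1 - j))) * X ^ (N - (N + 1 - 1 - j))).coeff i =
        if j = i then conj (f.coeff (N - i)) else 0 := by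
    intro j hj
    have hj : j ≤ N := Nat.lt_succ_iff.1 (Finset.mem_range.1 hj)
    rw [Nat.add_sub_cancel, Nat.sub_sub_self hj, coeff_C_mul, coeff_X_pow]
    rcases eq_or_ne j i with rfl | hne
    · simp
    · simp [hne, hne.symm]
  rw [Finset.sum_congr rfl hterm]
  simp

theorem natDegree_pstar_le (N : ℕ) (f : ℂ[X]) : (pstar N f).natDegree ≤ N :=
  natDegree_le_iff_coeff_eq_zero.2 fun i hi => by rw [coeff_pstar, if_neg (by lia)]

theorem pstar_eq_reflect (hf : f.natDegree ≤ N) : pstar N f = reflect N (f.map conj) := by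
  ext i
  rw [coeff_pstar, coeff_reflect, coeff_map]
  split_ifs with hi
  · rw [revAt_le hi]
  · rw [revAt_eq_self_of_lt (by lia), coeff_eq_zero_of_natDegree_lt (by lia), map_zero]

theorem pstar_pstar (hf : f.natDegree ≤ N) : pstar N (pstar N f) = f := by
  ext i
  rw [coeff_pstar]
  split_ifs with hi
  · rw [coeff_pstar, if_pos (Nat.sub_le N i), Nat.sub_sub_self hi, Complex.conj_conj]
  · exact (coeff_eq_zero_of_natDegree_lt (by lia)).symm

theorem pstar_ne_zero (hf : f.natDegree ≤ N) (hf0 : f ≠ 0) : pstar N f ≠ 0 := by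
  intro h
  rw [← pstar_pstar hf, h] at hf0
  exact hf0 (by simp [pstar])

theorem pstar_mul (hf : f.natDegree ≤ m) (hg : g.natDegree ≤ n) :
    pstar (m + n) (f * g) = pstar m f * pstar n g := by
  rw [pstar_eq_reflect hf, pstar_eq_reflect hg, pstar_eq_reflect (natDegree_mul_le_of_le hf hg),
    Polynomial.map_mul, reflect_mul _ _ (natDegree_map_le.trans hf) (natDegree_map_le.trans hg)]

theorem pstar_add_left (n : ℕ) (hf : f.natDegree ≤ N) : pstar (n + N) f = X ^ n * pstar N f := by
  have hone : pstar n 1 = X ^ n := by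
    rw [pstar_eq_reflect (by simp), Polynomial.map_one, reflect_one]
  rw [← hone, ← pstar_mul (by simp) hf, one_mul]

theorem pstar_X_sub_C (a : ℂ) : pstar 1 (X - C a) = 1 - C (conj a) * X := by
  ext i
  rw [coeff_pstar]
  rcases i with _ | _ | i <;> simp [coeff_one]

theorem pstar_X_sub_C_pow (a : ℂ) (m : ℕ) :
    pstar m ((X - C a) ^ m) = (1 - C (conj a) * X) ^ m := by
  induction m with
  | zero => simp [pstar]
  | succ m ih => rw [pow_succ, pstar_mul (by simp) (by simp), ih, pstar_X_sub_C, pow_succ]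

theorem eval_pstar (hf : f.natDegree ≤ N) (z : Circle) :
    (pstar N f).eval (z : ℂ) = z ^ N * conj (f.eval (z : ℂ)) := by
  rw [eval_eq_sum_range' (Nat.lt_succ_of_le hf), map_sum, pstar, eval_finsetSum, Finset.mul_sum]
  refine Finset.sum_congr rfl fun i hi => ?_
  have hi : i ≤ N := Nat.lt_succ_iff.1 (Finset.mem_range.1 hi)
  have hz : (z : ℂ) ^ i * conj (z : ℂ) ^ i = 1 := by
    rw [← mul_pow, Complex.mul_conj, Circle.normSq_coe, Complex.ofReal_one, one_pow]
  simp only [eval_mul, eval_C, eval_pow, eval_X, map_mul, map_pow]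
  rw [← pow_sub_mul_pow (z : ℂ) hi]
  linear_combination (-(conj (f.coeff i) * z ^ (N - i))) * hz

theorem one_sub_C_conj_mul_X {a : ℂ} (ha : a ≠ 0) :
    1 - C (conj a) * X = C (-conj a) * (X - C (conj a)⁻¹) := by
  have ha' : conj a ≠ 0 := (_root_.map_ne_zero _).2 ha
  rw [mul_sub, ← C_mul, neg_mul, mul_inv_cancel₀ ha']
  simp only [map_neg, map_one]
  ring

theorem rootMultiplicity_le_rootMultiplicity_pstar {a : ℂ} (ha : a ≠ 0) (hf : f.natDegree ≤ N)
    (hf0 : f ≠ 0) :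
    f.rootMultiplicity a ≤ (pstar N f).rootMultiplicity (conj a)⁻¹ := by
  rw [le_rootMultiplicity_iff (pstar_ne_zero hf hf0)]
  obtain ⟨g, hg⟩ := pow_rootMultiplicity_dvd f a
  set k := f.rootMultiplicity a
  have hg0 : g ≠ 0 := by rintro rfl; exact hf0 (by simpa using hg)
  have hdeg : f.natDegree = k + g.natDegree := by
    rw [hg, natDegree_mul (pow_ne_zero _ (X_sub_C_ne_zero a)) hg0, natDegree_pow, natDegree_X_sub_C,
      mul_one]
  obtain ⟨n, rfl⟩ : ∃ n, N = k + n := Nat.exists_eq_add_of_le (by lia)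
  rw [hg, pstar_mul (by simp) (by lia), pstar_X_sub_C_pow, one_sub_C_conj_mul_X ha, mul_pow]
  exact (dvd_mul_left _ _).mul_right _

theorem rootMultiplicity_pstar {a : ℂ} (ha : a ≠ 0) (hf : f.natDegree ≤ N) (hf0 : f ≠ 0) :
    (pstar N f).rootMultiplicity a = f.rootMultiplicity (conj a)⁻¹ := by
  have ha' : (conj a)⁻¹ ≠ 0 := inv_ne_zero ((_root_.map_ne_zero _).2 ha)
  apply le_antisymm
  · simpa only [pstar_pstar hf] using
      rootMultiplicity_le_rootMultiplicity_pstar ha (natDegree_pstar_le N f) (pstar_ne_zero hf hf0)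
  · simpa using rootMultiplicity_le_rootMultiplicity_pstar ha' hf hf0

end Reversal

section SelfInversive

variable {m n : ℕ} {f g : ℂ[X]}

/-- The polynomials `f` of degree at most `n` with `f* = f` (self-inversive polynomials), where the
reversal `f*` is taken with respect to the degree `n`. They form a real vector space only, since the
reversal is conjugate linear. -/
def selfInversive (n : ℕ) : Submodule ℝ ℂ[X] where
  carrier := {f | pstar n f = f}
  add_mem' {f g} (hf : pstar n f = f) (hg : pstar n g = g) := by
    change pstar n (f + g) = f + g
    conv_rhs => rw [← hf, ← hg]
    ext i
    simp only [coeff_pstar, coeff_add, map_add]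
    split_ifs <;> simp
  zero_mem' := by simp [pstar]
  smul_mem' c f (hf : pstar n f = f) := by
    change pstar n (c • f) = c • f
    conv_rhs => rw [← hf]
    ext i
    simp [coeff_pstar]

theorem mem_selfInversive : f ∈ selfInversive n ↔ pstar n f = f := Iff.rfl

theorem natDegree_le_of_mem_selfInversive (hf : f ∈ selfInversive n) : f.natDegree ≤ n := by
  rw [← mem_selfInversive.1 hf]
  exact natDegree_pstar_le n f

theorem coeff_of_mem_selfInversive (hf : f ∈ selfInversive n) {i : ℕ} (hi : i ≤ n) :
    f.coeff i = conj (f.coeff (n - i)) := by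
  conv_lhs => rw [← mem_selfInversive.1 hf, coeff_pstar, if_pos hi]

theorem one_mem_selfInversive : (1 : ℂ[X]) ∈ selfInversive 0 := by
  simp [mem_selfInversive, pstar]

theorem mul_mem_selfInversive (hf : f ∈ selfInversive m) (hg : g ∈ selfInversive n) :
    f * g ∈ selfInversive (m + n) := by
  rw [mem_selfInversive, pstar_mul (natDegree_le_of_mem_selfInversive hf)
    (natDegree_le_of_mem_selfInversive hg), mem_selfInversive.1 hf, mem_selfInversive.1 hg]

theorem prod_pow_mem_selfInversive {ι : Type*} (s : Finset ι) (e : ι → ℕ) {h : ι → ℂ[X]}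
    (hh : ∀ i, h i ∈ selfInversive n) :
    ∏ i ∈ s, h i ^ e i ∈ selfInversive (n * ∑ i ∈ s, e i) := by
  have hpow : ∀ i k, h i ^ k ∈ selfInversive (n * k) := by
    intro i k
    induction k with
    | zero => simpa using one_mem_selfInversive
    | succ k ih => simpa only [pow_succ, Nat.mul_succ] using mul_mem_selfInversive ih (hh i)
  classical
  induction s using Finset.induction_on with
  | empty => simpa using one_mem_selfInversive
  | insert i s hi ih =>
    simpa only [Finset.prod_insert hi, Finset.sum_insert hi, mul_add] using
      mul_mem_selfInversive (hpow i (e i)) ih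

/-- On the circle, `S / G` is the real function `q / p`. -/
theorem mem_selfInversive_of_mul_eq {N : ℕ} {p q S G : ℂ[X]} (hG : G ∈ selfInversive n)
    (hp : p.natDegree ≤ N) (hp0 : p ≠ 0) (hq : q.natDegree ≤ N) (hS : S * p = q * G)
    (hpq : q * pstar N p = pstar N q * p) : S ∈ selfInversive n := by
  have hSp : S * pstar N p = pstar N q * G :=
    mul_right_cancel₀ hp0 <| by linear_combination pstar N p * hS + G * hpq
  have hrev : pstar (S.natDegree + n) S = X ^ S.natDegree * S := by
    refine mul_right_cancel₀ (pstar_ne_zero hp hp0) ?_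
    calc pstar (S.natDegree + n) S * pstar N p
        = pstar (S.natDegree + (n + N)) (G * q) := by
          rw [← pstar_mul (by lia) hp, hS, mul_comm q, add_assoc]
      _ = X ^ S.natDegree * (G * pstar N q) := by
          have hGdeg := natDegree_le_of_mem_selfInversive hG
          rw [pstar_add_left _ (natDegree_mul_le_of_le hGdeg hq), pstar_mul hGdeg hq,
            mem_selfInversive.1 hG]
      _ = X ^ S.natDegree * S * pstar N p := by rw [mul_assoc, hSp, mul_comm G]
  have hdeg : S.natDegree ≤ n := by
    rcases eq_or_ne S 0 with rfl | hS0
    · simp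
    have := natDegree_pstar_le (S.natDegree + n) S
    rw [hrev, natDegree_mul (pow_ne_zero _ X_ne_zero) hS0, natDegree_X_pow] at this
    lia
  rw [pstar_add_left _ hdeg] at hrev
  exact mul_left_cancel₀ (pow_ne_zero _ X_ne_zero) hrev

end SelfInversive

section RootMultiplicity

theorem rootMultiplicity_prod_pow {R ι : Type*} [CommRing R] [IsDomain R] (s : Finset ι) (e : ι → ℕ)
    {h : ι → R[X]} (hh : ∀ i ∈ s, h i ≠ 0) (b : R) :
    (∏ i ∈ s, h i ^ e i).rootMultiplicity b = ∑ i ∈ s, e i * (h i).rootMultiplicity b := by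
  classical
  rw [← count_roots, roots_prod _ _ (Finset.prod_ne_zero_iff.2 fun i hi => pow_ne_zero _ (hh i hi)),
    Multiset.count_bind]
  simp only [roots_pow, Multiset.count_nsmul, count_roots, Finset.sum_map_val]

theorem dvd_of_forall_rootMultiplicity_le {K : Type*} [Field K] [IsAlgClosed K] {f g : K[X]}
    (hf : f ≠ 0) (hg : g ≠ 0) (h : ∀ b, f.rootMultiplicity b ≤ g.rootMultiplicity b) : f ∣ g := by
  classical
  rw [IsAlgClosed.dvd_iff_roots_le_roots hf hg, Multiset.le_iff_count]
  simpa only [count_roots] using h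

end RootMultiplicity

section GTilde

variable {N : ℕ} {p : ℂ[X]} {a b : ℂ}

/-- The self-inversive polynomial `(z - a) (1 - conj(a) z)`, whose zeros are `a` and the point
symmetric to `a` with respect to the unit circle. -/
def conjPair (a : ℂ) : ℂ[X] := (X - C a) * (1 - C (conj a) * X)

theorem conjPair_mem_selfInversive (a : ℂ) : conjPair a ∈ selfInversive 2 := by
  have hdeg : (X - C a).natDegree ≤ 1 := (natDegree_X_sub_C a).le
  have hrev : pstar 1 (1 - C (conj a) * X) = X - C a := by
    rw [← pstar_X_sub_C, pstar_pstar hdeg]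
  rw [mem_selfInversive, conjPair, ← one_add_one_eq_two,
    pstar_mul hdeg (pstar_X_sub_C a ▸ natDegree_pstar_le 1 _), hrev,
    pstar_X_sub_C, mul_comm]

theorem conjPair_ne_zero (a : ℂ) : conjPair a ≠ 0 := by
  refine mul_ne_zero (X_sub_C_ne_zero a) fun h => ?_
  simpa using congrArg (eval 0) h

theorem rootMultiplicity_conjPair_of_norm_lt_one (ha : ‖a‖ < 1) (hb : ‖b‖ ≤ 1) :
    (conjPair a).rootMultiplicity b = if b = a then 1 else 0 := by
  have hroot : ¬ (1 - C (conj a) * X).IsRoot b := by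
    intro h
    have hab : conj a * b = 1 := (sub_eq_zero.1 (by simpa using h)).symm
    have hnorm : ‖a‖ * ‖b‖ = 1 := by rw [← Complex.norm_conj a, ← norm_mul, hab, norm_one]
    nlinarith [norm_nonneg a]
  rw [conjPair, rootMultiplicity_mul (conjPair_ne_zero a), rootMultiplicity_X_sub_C,
    rootMultiplicity_eq_zero hroot, add_zero]

theorem rootMultiplicity_conjPair_of_norm_eq_one (ha : ‖a‖ = 1) (b : ℂ) :
    (conjPair a).rootMultiplicity b = if b = a then 2 else 0 := by
  have ha0 : a ≠ 0 := norm_ne_zero_iff.1 (ha ▸ one_ne_zero)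
  have hsymm : (conj a)⁻¹ = a := by rw [← Complex.inv_eq_conj ha, inv_inv]
  have hC : C (-conj a) ≠ 0 := C_ne_zero.2 (neg_ne_zero.2 ((_root_.map_ne_zero _).2 ha0))
  rw [conjPair, rootMultiplicity_mul (conjPair_ne_zero a), one_sub_C_conj_mul_X ha0, hsymm,
    rootMultiplicity_mul (mul_ne_zero hC (X_sub_C_ne_zero a)), rootMultiplicity_C,
    rootMultiplicity_X_sub_C]
  split_ifs <;> rfl

theorem G_eq_prod_conjPair (N : ℕ) (p : ℂ[X]) :
    G N p = ∏ a ∈ diskZeros N p, conjPair a ^ diskMult N p a := by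
  simp only [G, conjPair, mul_pow]

theorem G₀_eq_prod_conjPair (p : ℂ[X]) :
    G₀ p = ∏ ζ ∈ circleZeros p, conjPair ζ ^ circleMult p ζ := by
  simp only [G₀, conjPair, mul_pow]

theorem GTilde_mem_selfInversive (N : ℕ) (p : ℂ[X]) :
    GTilde N p ∈ selfInversive (2 * mTilde N p) := by
  rw [GTilde, G_eq_prod_conjPair, G₀_eq_prod_conjPair, mTilde, mul_add]
  exact mul_mem_selfInversive (prod_pow_mem_selfInversive _ _ conjPair_mem_selfInversive)
    (prod_pow_mem_selfInversive _ _ conjPair_mem_selfInversive)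

theorem GTilde_ne_zero (N : ℕ) (p : ℂ[X]) : GTilde N p ≠ 0 := by
  rw [GTilde, G_eq_prod_conjPair, G₀_eq_prod_conjPair]
  exact mul_ne_zero (Finset.prod_ne_zero_iff.2 fun a _ => pow_ne_zero _ (conjPair_ne_zero a))
    (Finset.prod_ne_zero_iff.2 fun a _ => pow_ne_zero _ (conjPair_ne_zero a))

theorem diskMult_eq_zero_of_notMem (hb : ‖b‖ < 1) (h : b ∉ diskZeros N p) : diskMult N p b = 0 := by
  simp only [diskZeros, Finset.mem_filter, Finset.mem_inter, Multiset.mem_toFinset, hb, and_true,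
    not_and_or] at h
  rw [diskMult, ← count_roots, ← count_roots, Nat.min_eq_zero_iff]
  exact h.imp Multiset.count_eq_zero_of_notMem Multiset.count_eq_zero_of_notMem

theorem circleMult_eq_zero_of_notMem (hb : ‖b‖ = 1) (h : b ∉ circleZeros p) :
    circleMult p b = 0 := by
  simp only [circleZeros, Finset.mem_filter, Multiset.mem_toFinset, hb, and_true] at h
  rw [circleMult, ← count_roots, Multiset.count_eq_zero_of_notMem h, Nat.zero_div]

theorem rootMultiplicity_G (hb : ‖b‖ ≤ 1) :
    (G N p).rootMultiplicity b = if b ∈ diskZeros N p then diskMult N p b else 0 := by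
  rw [G_eq_prod_conjPair, rootMultiplicity_prod_pow _ _ fun a _ => conjPair_ne_zero a]
  trans ∑ a ∈ diskZeros N p, if b = a then diskMult N p a else 0
  · refine Finset.sum_congr rfl fun a ha => ?_
    rw [rootMultiplicity_conjPair_of_norm_lt_one (Finset.mem_filter.1 ha).2 hb, mul_ite, mul_one,
      mul_zero]
  · exact Finset.sum_ite_eq _ _ _

theorem rootMultiplicity_G₀ (b : ℂ) :
    (G₀ p).rootMultiplicity b = if b ∈ circleZeros p then 2 * circleMult p b else 0 := by
  rw [G₀_eq_prod_conjPair, rootMultiplicity_prod_pow _ _ fun a _ => conjPair_ne_zero a]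
  trans ∑ ζ ∈ circleZeros p, if b = ζ then 2 * circleMult p ζ else 0
  · refine Finset.sum_congr rfl fun ζ hζ => ?_
    rw [rootMultiplicity_conjPair_of_norm_eq_one (Finset.mem_filter.1 hζ).2, mul_ite, mul_zero,
      mul_comm]
  · exact Finset.sum_ite_eq _ _ _

theorem rootMultiplicity_GTilde_of_norm_eq_one (N : ℕ) (p : ℂ[X]) (hb : ‖b‖ = 1) :
    (GTilde N p).rootMultiplicity b = 2 * circleMult p b := by
  have hmem : b ∉ diskZeros N p := fun h => (Finset.mem_filter.1 h).2.ne hb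
  rw [GTilde, rootMultiplicity_mul (GTilde_ne_zero N p), rootMultiplicity_G hb.le, if_neg hmem,
    rootMultiplicity_G₀, zero_add]
  split_ifs with h
  · rfl
  · rw [circleMult_eq_zero_of_notMem hb h]

theorem rootMultiplicity_GTilde_of_norm_lt_one (N : ℕ) (p : ℂ[X]) (hb : ‖b‖ < 1) :
    (GTilde N p).rootMultiplicity b = diskMult N p b := by
  have hmem : b ∉ circleZeros p := fun h => hb.ne (Finset.mem_filter.1 h).2
  rw [GTilde, rootMultiplicity_mul (GTilde_ne_zero N p), rootMultiplicity_G hb.le,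
    rootMultiplicity_G₀, if_neg hmem, add_zero]
  split_ifs with h
  · rfl
  · rw [diskMult_eq_zero_of_notMem hb h]

theorem diskMult_inv_conj (hp : p.natDegree ≤ N) (hp0 : p ≠ 0) (hb : b ≠ 0) :
    diskMult N p (conj b)⁻¹ = diskMult N p b := by
  have hb' : (conj b)⁻¹ ≠ 0 := inv_ne_zero ((_root_.map_ne_zero _).2 hb)
  rw [diskMult, diskMult, rootMultiplicity_pstar hb' hp hp0, rootMultiplicity_pstar hb hp hp0,
    map_inv₀, Complex.conj_conj, inv_inv, min_comm]

/-- Outside the closed disk this follows from the symmetry of both sides under `b ↦ 1 / conj b`. -/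
theorem rootMultiplicity_GTilde_of_norm_ne_one (hp : p.natDegree ≤ N) (hp0 : p ≠ 0)
    (hb : ‖b‖ ≠ 1) : (GTilde N p).rootMultiplicity b = diskMult N p b := by
  rcases hb.lt_or_gt with hlt | hgt
  · exact rootMultiplicity_GTilde_of_norm_lt_one N p hlt
  have hb0 : b ≠ 0 := norm_pos_iff.1 (one_pos.trans hgt)
  have hlt : ‖(conj b)⁻¹‖ < 1 := by
    rw [norm_inv, Complex.norm_conj]
    exact inv_lt_one_of_one_lt₀ hgt
  have hG := GTilde_mem_selfInversive N p
  calc (GTilde N p).rootMultiplicity b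
      = (pstar (2 * mTilde N p) (GTilde N p)).rootMultiplicity b := by
        rw [mem_selfInversive.1 hG]
    _ = (GTilde N p).rootMultiplicity (conj b)⁻¹ :=
        rootMultiplicity_pstar hb0 (natDegree_le_of_mem_selfInversive hG) (GTilde_ne_zero N p)
    _ = diskMult N p (conj b)⁻¹ := rootMultiplicity_GTilde_of_norm_lt_one N p hlt
    _ = diskMult N p b := diskMult_inv_conj hp hp0 hb0

theorem GTilde_dvd (hp : p.natDegree ≤ N) (hp0 : p ≠ 0) : GTilde N p ∣ p := by
  refine dvd_of_forall_rootMultiplicity_le (GTilde_ne_zero N p) hp0 fun b => ?_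
  by_cases hb : ‖b‖ = 1
  · rw [rootMultiplicity_GTilde_of_norm_eq_one N p hb]
    exact Nat.mul_div_le _ 2
  · rw [rootMultiplicity_GTilde_of_norm_ne_one hp hp0 hb]
    exact min_le_left _ _

theorem GTilde_mul_RTilde (hp : p.natDegree ≤ N) (hp0 : p ≠ 0) : GTilde N p * RTilde N p = p :=
  EuclideanDomain.mul_div_cancel' (GTilde_ne_zero N p) (GTilde_dvd hp hp0)

end GTilde

section Circle

variable {N : ℕ} {f g p q : ℂ[X]}

theorem eq_of_forall_eval_circle_eq (h : ∀ z : Circle, f.eval (z : ℂ) = g.eval (z : ℂ)) :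
    f = g := by
  have : Infinite Circle := Set.infinite_univ_iff.1 <|
    ((Set.Ico_infinite Real.two_pi_pos).image (Circle.exp_injOn_Ico (sub_zero _).le)).mono
      (Set.subset_univ _)
  have hrange : (Set.range ((↑) : Circle → ℂ)).Infinite :=
    Set.infinite_range_of_injective (α := Circle) Circle.coe_injective
  exact eq_of_infinite_eval_eq f g (hrange.mono (Set.range_subset_iff.2 h))

theorem eq_zero_of_forall_smul_nonneg {α E : Type*} [TopologicalSpace α] [TopologicalSpace E]
    [AddCommGroup E] [PartialOrder E] [IsOrderedAddMonoid E] [Module ℝ E] [PosSMulMono ℝ E]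
    [OrderClosedTopology E] {a : α} {u : α → ℝ} {v : α → E} (hpos : ∃ᶠ s in nhds a, 0 < u s)
    (hneg : ∃ᶠ s in nhds a, u s < 0) (hv : ContinuousAt v a) (h : ∀ s, 0 ≤ u s • v s) :
    v a = 0 := by
  apply le_antisymm
  · refine le_of_tendsto_of_frequently hv (hneg.mono fun s hs => ?_)
    exact (smul_le_smul_iff_of_neg_left hs).1 ((smul_zero (u s)).trans_le (h s))
  · refine ge_of_tendsto_of_frequently hv (hpos.mono fun s hs => ?_)
    exact nonneg_of_smul_nonneg_of_pos_left (h s) hs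

theorem frequently_sin_pow_pos (k : ℕ) : ∃ᶠ s in nhds (0 : ℝ), 0 < Real.sin s ^ k := by
  have h : ∀ᶠ s in nhdsWithin (0 : ℝ) (Set.Ioi 0), 0 < Real.sin s ^ k := by
    filter_upwards [Ioo_mem_nhdsGT Real.pi_pos] with s hs
    exact pow_pos (Real.sin_pos_of_mem_Ioo hs) k
  exact h.frequently.filter_mono nhdsWithin_le_nhds

theorem frequently_sin_pow_neg {k : ℕ} (hk : Odd k) :
    ∃ᶠ s in nhds (0 : ℝ), Real.sin s ^ k < 0 := by
  have h : ∀ᶠ s in nhdsWithin (0 : ℝ) (Set.Iio 0), Real.sin s ^ k < 0 := by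
    filter_upwards [Ioo_mem_nhdsLT (neg_lt_zero.2 Real.pi_pos)] with s hs
    exact hk.pow_neg (Real.sin_neg_of_neg_of_neg_pi_lt hs.2 hs.1)
  exact h.frequently.filter_mono nhdsWithin_le_nhds

theorem coe_mul_exp_two_mul_sub (b : Circle) (s : ℝ) :
    ((b * Circle.exp (2 * s) : Circle) : ℂ) - b =
      Real.sin s * (2 * Complex.I * b * Circle.exp s) := by
  have hexp : Complex.exp (s * Complex.I) = Real.cos s + Real.sin s * Complex.I := by
    rw [Complex.exp_mul_I, Complex.ofReal_cos, Complex.ofReal_sin]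
  have hsq : (Real.cos s : ℂ) ^ 2 + (Real.sin s : ℂ) ^ 2 = 1 := by
    exact_mod_cast Real.cos_sq_add_sin_sq s
  rw [two_mul, Circle.exp_add, Circle.coe_mul, Circle.coe_mul, Circle.coe_exp, hexp]
  linear_combination (b : ℂ) * hsq - (b : ℂ) * Real.sin s ^ 2 * Complex.I_sq

/-- At a zero of odd order the function `f(z) / z^N` would change its sign along the circle. -/
theorem even_rootMultiplicity_of_forall_circle_nonneg (hf0 : f ≠ 0)
    (hf : ∀ z : Circle, 0 ≤ f.eval (z : ℂ) / (z : ℂ) ^ N) (b : Circle) :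
    Even (f.rootMultiplicity (b : ℂ)) := by
  obtain ⟨h, hfh, hh⟩ := exists_eq_pow_rootMultiplicity_mul_and_not_dvd f hf0 (b : ℂ)
  set k := f.rootMultiplicity (b : ℂ)
  by_contra hk
  let z (s : ℝ) : Circle := b * Circle.exp (2 * s)
  let v (s : ℝ) : ℂ := (2 * Complex.I * b * Circle.exp s) ^ k * h.eval (z s : ℂ) / (z s : ℂ) ^ N
  have hfactor : ∀ s, f.eval (z s : ℂ) / (z s : ℂ) ^ N = Real.sin s ^ k • v s := by
    intro s
    rw [hfh, eval_mul, eval_pow, eval_sub, eval_X, eval_C, coe_mul_exp_two_mul_sub, mul_pow,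
      mul_assoc, mul_div_assoc, Complex.real_smul, Complex.ofReal_pow]
  have hcont : Continuous v := by
    have : Continuous fun s => (z s : ℂ) := by fun_prop
    exact Continuous.div (by fun_prop) (by fun_prop) fun s => pow_ne_zero _ (z s).coe_ne_zero
  have hv : v 0 = 0 := eq_zero_of_forall_smul_nonneg (frequently_sin_pow_pos k)
    (frequently_sin_pow_neg (Nat.not_even_iff_odd.1 hk)) hcont.continuousAt
    fun s => hfactor s ▸ hf (z s)
  refine hh (dvd_iff_isRoot.2 ?_)
  simpa [v, z] using hv

end Circle

section Cofactor

variable {N : ℕ} {p q : ℂ[X]}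

theorem mul_pstar_eq_pstar_mul (hp : p.natDegree ≤ N) (hq : q.natDegree ≤ N)
    (h : ∀ z : Circle, 0 ≤ q.eval (z : ℂ) * conj (p.eval (z : ℂ))) :
    q * pstar N p = pstar N q * p := by
  refine eq_of_forall_eval_circle_eq fun z => ?_
  have hreal : conj (q.eval (z : ℂ)) * p.eval (z : ℂ) = q.eval (z : ℂ) * conj (p.eval (z : ℂ)) := by
    simpa using (IsSelfAdjoint.of_nonneg (h z)).star_eq
  rw [eval_mul, eval_mul, eval_pstar hp, eval_pstar hq]
  linear_combination (-(z : ℂ) ^ N) * hreal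

theorem even_rootMultiplicity_add (hp : p.natDegree ≤ N) (hp0 : p ≠ 0) (hq0 : q ≠ 0)
    (h : ∀ z : Circle, 0 ≤ q.eval (z : ℂ) * conj (p.eval (z : ℂ))) {b : ℂ} (hb : ‖b‖ = 1) :
    Even (q.rootMultiplicity b + p.rootMultiplicity b) := by
  have hb0 : b ≠ 0 := norm_ne_zero_iff.1 (hb ▸ one_ne_zero)
  have hqp : q * pstar N p ≠ 0 := mul_ne_zero hq0 (pstar_ne_zero hp hp0)
  have hquot : ∀ z : Circle, 0 ≤ (q * pstar N p).eval (z : ℂ) / (z : ℂ) ^ N := by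
    intro z
    rw [eval_mul, eval_pstar hp, mul_left_comm,
      mul_div_cancel_left₀ _ (pow_ne_zero N z.coe_ne_zero)]
    exact h z
  have heven := even_rootMultiplicity_of_forall_circle_nonneg hqp hquot
    ⟨b, mem_sphere_zero_iff_norm.2 hb⟩
  rwa [rootMultiplicity_mul hqp, rootMultiplicity_pstar hb0 hp hp0, ← Complex.inv_eq_conj hb,
    inv_inv] at heven

/-- At a zero `b` off the circle, `q p* = q* p` shows that `q` cancels the surplus of the order of
`p` over that of `p*`; on the circle, parity makes `q` vanish where `p` has odd order. -/
theorem RTilde_dvd (hp : p.natDegree ≤ N) (hp0 : p ≠ 0) (hq : q.natDegree ≤ N)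
    (h : ∀ z : Circle, 0 ≤ q.eval (z : ℂ) * conj (p.eval (z : ℂ))) : RTilde N p ∣ q := by
  rcases eq_or_ne q 0 with rfl | hq0
  · exact dvd_zero _
  have hpR := GTilde_mul_RTilde hp hp0
  have hpR0 : GTilde N p * RTilde N p ≠ 0 := by rwa [hpR]
  refine dvd_of_forall_rootMultiplicity_le (right_ne_zero_of_mul hpR0) hq0 fun b => ?_
  have hp_mult : p.rootMultiplicity b =
      (GTilde N p).rootMultiplicity b + (RTilde N p).rootMultiplicity b := by
    rw [← rootMultiplicity_mul hpR0, hpR]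
  by_cases hb : ‖b‖ = 1
  · obtain ⟨r, hr⟩ := even_rootMultiplicity_add hp hp0 hq0 h hb
    rw [rootMultiplicity_GTilde_of_norm_eq_one N p hb, circleMult] at hp_mult
    lia
  · have hpq := congrArg (rootMultiplicity b) (mul_pstar_eq_pstar_mul hp hq h)
    rw [rootMultiplicity_mul (mul_ne_zero hq0 (pstar_ne_zero hp hp0)),
      rootMultiplicity_mul (mul_ne_zero (pstar_ne_zero hq hq0) hp0)] at hpq
    rw [rootMultiplicity_GTilde_of_norm_ne_one hp hp0 hb, diskMult] at hp_mult
    lia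

theorem exists_mem_selfInversive_mul_RTilde_eq (hp : p.natDegree ≤ N) (hp0 : p ≠ 0)
    (hq : q.natDegree ≤ N) (h : ∀ z : Circle, 0 ≤ q.eval (z : ℂ) * conj (p.eval (z : ℂ))) :
    ∃ S ∈ selfInversive (2 * mTilde N p), S * RTilde N p = q := by
  obtain ⟨S, rfl⟩ := RTilde_dvd hp hp0 hq h
  refine ⟨S, mem_selfInversive_of_mul_eq (GTilde_mem_selfInversive N p) hp hp0 hq ?_
    (mul_pstar_eq_pstar_mul hp hq h), mul_comm _ _⟩
  conv_lhs => rw [← GTilde_mul_RTilde hp hp0]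
  ring

end Cofactor

section RankCondition

variable {N M m : ℕ} {k : Fin M → ℕ} {p q S : ℂ[X]}

theorem natDegree_le_of_mem_lacunary_admissible (hp : p ∈ lacunary (admissible N k)) :
    p.natDegree ≤ N :=
  natDegree_le_iff_coeff_eq_zero.2 fun i hi => hp i (by simp [admissible, hi])

theorem coeff_eq_zero_of_mem_lacunary_admissible (hp : p ∈ lacunary (admissible N k))
    (j : Fin M) : p.coeff (k j) = 0 :=
  hp (k j) (by simp [admissible])

/-- Real coordinates of a polynomial `S` in `selfInversive (2 * m)`, ordered as the columns of
`MTilde`. The middle coefficient is real, and it is halved since the column `l = 0` of `MTilde`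
counts it twice. -/
def symCoords (m : ℕ) : ℂ[X] →ₗ[ℝ] (Fin (m + 1) ⊕ Fin m → ℝ) where
  toFun S := Sum.elim
    (Fin.cons ((S.coeff m).re / 2) fun i : Fin m => (S.coeff (m + (i + 1))).re)
    fun i => (S.coeff (m + (i + 1))).im
  map_add' S T := by
    ext (l | i)
    · refine Fin.cases ?_ (fun i => ?_) l <;> simp [add_div]
    · simp
  map_smul' c S := by
    ext (l | i)
    · refine Fin.cases ?_ (fun i => ?_) l <;> simp [mul_div_assoc]
    · simp

theorem im_coeff_eq_zero_of_mem_selfInversive (hS : S ∈ selfInversive (2 * m)) :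
    (S.coeff m).im = 0 := by
  have h := coeff_of_mem_selfInversive hS (i := m) (by lia)
  rw [show 2 * m - m = m by lia] at h
  exact Complex.conj_eq_iff_im.1 h.symm

theorem eq_zero_of_symCoords_eq_zero (hS : S ∈ selfInversive (2 * m)) (h : symCoords m S = 0) :
    S = 0 := by
  have hupper : ∀ l ≤ m, S.coeff (m + l) = 0 := by
    rintro (_ | l) hl
    · have hre : (S.coeff m).re / 2 = 0 := congrFun h (Sum.inl 0)
      exact Complex.ext (by simpa using hre) (im_coeff_eq_zero_of_mem_selfInversive hS)
    · exact Complex.ext (congrFun h (Sum.inl (Fin.succ ⟨l, hl⟩))) (congrFun h (Sum.inr ⟨l, hl⟩))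
  ext i
  rw [coeff_zero]
  rcases lt_or_ge (2 * m) i with hi | hi
  · exact coeff_eq_zero_of_natDegree_lt ((natDegree_le_of_mem_selfInversive hS).trans_lt hi)
  rcases le_total m i with hmi | him
  · simpa only [Nat.add_sub_cancel' hmi] using hupper (i - m) (by lia)
  · rw [coeff_of_mem_selfInversive hS hi, show 2 * m - i = m + (m - i) by lia,
      hupper (m - i) (Nat.sub_le m i), map_zero]

theorem sum_range_two_mul_add_one {A : Type*} [AddCommMonoid A] (f : ℕ → A) (m : ℕ) :
    ∑ i ∈ Finset.range (2 * m + 1), f i =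
      f m + ∑ i : Fin m, (f (m + (i + 1)) + f (m - (i + 1))) := by
  have hlower : ∑ i ∈ Finset.range m, f i = ∑ i ∈ Finset.range m, f (m - (i + 1)) := by
    rw [← Finset.sum_range_reflect]
    exact Finset.sum_congr rfl fun i _ => by rw [Nat.sub_sub, add_comm 1]
  have hupper : ∀ i, f (m + 1 + i) = f (m + (i + 1)) := fun i => by rw [add_assoc, add_comm 1]
  rw [show 2 * m + 1 = m + 1 + m by ring, Finset.sum_range_add, Finset.sum_range_succ, hlower,
    Finset.sum_congr rfl fun i _ => hupper i, Finset.sum_add_distrib,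
    Fin.sum_univ_eq_sum_range fun i => f (m + (i + 1)),
    Fin.sum_univ_eq_sum_range fun i => f (m - (i + 1))]
  abel

theorem coeff_mul_RTilde {d : ℕ} (hS : S.natDegree ≤ d) (n : ℕ) :
    (S * RTilde N p).coeff n =
      ∑ i ∈ Finset.range (d + 1), S.coeff i * CTilde N p ((n : ℤ) - i) := by
  conv_lhs =>
    rw [as_sum_range_C_mul_X_pow' S (Nat.lt_succ_of_le hS), Finset.sum_mul, finsetSum_coeff]
  refine Finset.sum_congr rfl fun i _ => ?_
  simp only [mul_assoc, coeff_C_mul, coeff_X_pow_mul', CTilde, sub_nonneg, Nat.cast_le,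
    Int.toNat_sub]

theorem coeff_mul_RTilde_of_mem_selfInversive (hS : S ∈ selfInversive (2 * m)) (n : ℕ) :
    (S * RTilde N p).coeff n = ((S.coeff m).re : ℂ) * CTilde N p ((n : ℤ) - m) +
      ∑ i : Fin m, (S.coeff (m + (i + 1)) * CTilde N p ((n : ℤ) - ((i : ℕ) + 1) - m) +
        conj (S.coeff (m + (i + 1))) * CTilde N p ((n : ℤ) + ((i : ℕ) + 1) - m)) := by
  have hm : ((S.coeff m).re : ℂ) = S.coeff m :=
    Complex.ext rfl (im_coeff_eq_zero_of_mem_selfInversive hS).symm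
  rw [coeff_mul_RTilde (natDegree_le_of_mem_selfInversive hS), sum_range_two_mul_add_one, hm]
  congr 1
  refine Finset.sum_congr rfl fun i _ => ?_
  have hi : (i : ℕ) + 1 ≤ m := i.2
  rw [coeff_of_mem_selfInversive hS (i := m - (i + 1)) (by lia),
    show 2 * m - (m - (i + 1)) = m + (i + 1) by lia]
  congr 3 <;> push_cast [Nat.cast_sub hi] <;> ring

theorem MTilde_mulVec_symCoords (hS : S ∈ selfInversive (2 * mTilde N p)) :
    (MTilde N k p).mulVec (symCoords (mTilde N p) S) =
      Sum.elim (fun j => ((S * RTilde N p).coeff (k j)).re)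
        fun j => ((S * RTilde N p).coeff (k j)).im := by
  rw [MTilde, Matrix.fromBlocks_mulVec]
  congr 1
  · funext j
    rw [coeff_mul_RTilde_of_mem_selfInversive hS]
    simp only [Pi.add_apply, Matrix.mulVec, dotProduct, symCoords, LinearMap.coe_mk, AddHom.coe_mk,
      Sum.elim_comp_inl, Sum.elim_comp_inr, APlus, BMinus, Matrix.of_apply, Fin.sum_univ_succ,
      Fin.cons_zero, Fin.cons_succ, ATilde, BTilde, Complex.add_re, Complex.re_sum, Complex.mul_re,
      Complex.ofReal_re, Complex.ofReal_im, Complex.conj_re, Complex.conj_im, Fin.val_zero,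
      Fin.val_succ, Nat.cast_zero, add_zero, sub_zero, add_assoc, ← Finset.sum_add_distrib,
      Nat.cast_add, Nat.cast_one]
    congr 1
    · ring
    · exact Finset.sum_congr rfl fun i _ => by ring
  · funext j
    rw [coeff_mul_RTilde_of_mem_selfInversive hS]
    simp only [Pi.add_apply, Matrix.mulVec, dotProduct, symCoords, LinearMap.coe_mk, AddHom.coe_mk,
      Sum.elim_comp_inl, Sum.elim_comp_inr, BPlus, AMinus, Matrix.of_apply, Matrix.neg_apply,
      Fin.sum_univ_succ, Fin.cons_zero, Fin.cons_succ, ATilde, BTilde, Complex.add_im,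
      Complex.im_sum, Complex.mul_im, Complex.ofReal_re, Complex.ofReal_im, Complex.conj_re,
      Complex.conj_im, Fin.val_zero, Fin.val_succ, Nat.cast_zero, zero_mul, add_zero, sub_zero,
      add_assoc, ← Finset.sum_add_distrib, Nat.cast_add, Nat.cast_one]
    congr 1
    · ring
    · exact Finset.sum_congr rfl fun i _ => by ring

theorem MTilde_mulVec_symCoords_eq_zero (hS : S ∈ selfInversive (2 * mTilde N p))
    (hSR : S * RTilde N p ∈ lacunary (admissible N k)) :
    (MTilde N k p).mulVec (symCoords (mTilde N p) S) = 0 := by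
  rw [MTilde_mulVec_symCoords hS]
  ext (j | j) <;> simp [coeff_eq_zero_of_mem_lacunary_admissible hSR]

theorem exists_smul_eq_of_mulVec_eq_zero {m n K : Type*} [Fintype n] [Field K]
    {A : Matrix m n K} (hA : Fintype.card n ≤ A.rank + 1) {v w : n → K} (hv0 : v ≠ 0)
    (hv : A.mulVec v = 0) (hw : A.mulVec w = 0) : ∃ c : K, c • v = w := by
  have hker : Module.finrank K A.mulVecLin.ker ≤ 1 := by
    have h := A.mulVecLin.finrank_range_add_finrank_ker
    rw [Module.finrank_fintype_fun_eq_card, ← Matrix.rank] at h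
    lia
  obtain ⟨u, hu⟩ := finrank_le_one_iff.1 hker
  obtain ⟨a, ha⟩ := hu ⟨v, hv⟩
  obtain ⟨b, hb⟩ := hu ⟨w, hw⟩
  have ha' : a • (u : n → K) = v := congrArg Subtype.val ha
  have hb' : b • (u : n → K) = w := congrArg Subtype.val hb
  have ha0 : a ≠ 0 := by
    rintro rfl
    exact hv0 (by rw [← ha', zero_smul])
  exact ⟨b * a⁻¹, by rw [← ha', ← hb', smul_smul, inv_mul_cancel_right₀ ha0]⟩

theorem exists_eq_smul_of_rank_MTilde (hp : p ∈ lacunary (admissible N k)) (hp0 : p ≠ 0)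
    (hrank : (MTilde N k p).rank = 2 * mTilde N p) (hq : q ∈ lacunary (admissible N k))
    (h : ∀ z : Circle, 0 ≤ q.eval (z : ℂ) * conj (p.eval (z : ℂ))) : ∃ c : ℝ, q = c • p := by
  have hp_deg := natDegree_le_of_mem_lacunary_admissible hp
  have hG := GTilde_mem_selfInversive N p
  have hGR := GTilde_mul_RTilde hp_deg hp0
  obtain ⟨S, hS, rfl⟩ := exists_mem_selfInversive_mul_RTilde_eq hp_deg hp0
    (natDegree_le_of_mem_lacunary_admissible hq) h
  obtain ⟨c, hc⟩ : ∃ c : ℝ, c • symCoords (mTilde N p) (GTilde N p) = symCoords (mTilde N p) S := by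
    refine exists_smul_eq_of_mulVec_eq_zero (A := MTilde N k p) ?_
      (fun h0 => GTilde_ne_zero N p (eq_zero_of_symCoords_eq_zero hG h0))
      (MTilde_mulVec_symCoords_eq_zero hG (hGR.symm ▸ hp)) (MTilde_mulVec_symCoords_eq_zero hS hq)
    rw [hrank, Fintype.card_sum, Fintype.card_fin, Fintype.card_fin]
    lia
  have hSG : S - c • GTilde N p = 0 :=
    eq_zero_of_symCoords_eq_zero (Submodule.sub_mem _ hS (Submodule.smul_mem _ c hG))
      (by rw [map_sub, map_smul, hc, sub_self])
  exact ⟨c, by rw [sub_eq_zero.1 hSG, smul_mul_assoc, hGR]⟩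

end RankCondition

section SignFunctional

variable {α : Type*} [MeasurableSpace α] {μ : Measure α}

theorem norm_conj_div_norm_le_one (w : ℂ) : ‖conj w / (‖w‖ : ℂ)‖ ≤ 1 := by
  rw [norm_div, Complex.norm_conj, Complex.norm_real, norm_norm]
  exact div_self_le_one _

theorem aestronglyMeasurable_conj_div_norm (f : Lp ℂ 1 μ) :
    AEStronglyMeasurable (fun x => conj (f x) / (‖f x‖ : ℂ)) μ := by
  have : AEMeasurable f μ := (Lp.aestronglyMeasurable f).aemeasurable
  exact (by fun_prop : AEMeasurable (fun x => conj (f x) / (‖f x‖ : ℂ)) μ).aestronglyMeasurable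

theorem memLp_top_conj_div_norm (f : Lp ℂ 1 μ) :
    MemLp (fun x => conj (f x) / (‖f x‖ : ℂ)) ∞ μ :=
  memLp_top_of_bound (aestronglyMeasurable_conj_div_norm f) 1
    (ae_of_all μ fun x => norm_conj_div_norm_le_one (f x))

/-- Integration against `conj(f) / |f|`, the functional that norms `f`. Division by zero makes the
density `0` where `f` vanishes. -/
def signFunctional (f : Lp ℂ 1 μ) : Lp ℂ 1 μ →L[ℂ] ℂ :=
  (ContinuousLinearMap.mul ℂ ℂ).lpPairing μ ∞ 1 (memLp_top_conj_div_norm f).toLp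

theorem signFunctional_apply (f g : Lp ℂ 1 μ) :
    signFunctional f g = ∫ x, conj (f x) / (‖f x‖ : ℂ) * g x ∂μ := by
  rw [signFunctional, ContinuousLinearMap.lpPairing_eq_integral]
  refine integral_congr_ae ?_
  filter_upwards [(memLp_top_conj_div_norm f).coeFn_toLp] with x hx
  rw [hx, ContinuousLinearMap.mul_apply']

theorem norm_conj_div_norm_mul_le (w z : ℂ) : ‖conj w / (‖w‖ : ℂ) * z‖ ≤ ‖z‖ := by
  rw [norm_mul]
  exact mul_le_of_le_one_left (norm_nonneg z) (norm_conj_div_norm_le_one w)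

theorem norm_signFunctional_le_one (f : Lp ℂ 1 μ) : ‖signFunctional f‖ ≤ 1 := by
  refine ContinuousLinearMap.opNorm_le_bound _ zero_le_one fun g => ?_
  rw [signFunctional_apply, one_mul, L1.norm_eq_integral_norm]
  exact norm_integral_le_of_norm_le (L1.integrable_coeFn g).norm
    (ae_of_all μ fun x => norm_conj_div_norm_mul_le (f x) (g x))

theorem signFunctional_self (f : Lp ℂ 1 μ) : signFunctional f f = ‖f‖ := by
  rw [signFunctional_apply, L1.norm_eq_integral_norm, ← integral_complex_ofReal]
  congr 1 with x
  rw [div_mul_eq_mul_div, Complex.conj_mul', sq, mul_self_div_self]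

theorem ae_nonneg_mul_conj_of_signFunctional_eq_norm {f g : Lp ℂ 1 μ}
    (h : signFunctional f g = ‖g‖) : ∀ᵐ x ∂μ, 0 ≤ g x * conj (f x) := by
  set u : α → ℂ := fun x => conj (f x) / (‖f x‖ : ℂ)
  have hg : Integrable g μ := L1.integrable_coeFn g
  have hug : Integrable (fun x => u x * g x) μ :=
    hg.bdd_mul (aestronglyMeasurable_conj_div_norm f)
      (ae_of_all μ fun x => norm_conj_div_norm_le_one (f x))
  have hle : ∀ x, (u x * g x).re ≤ ‖g x‖ := fun x =>
    (Complex.re_le_norm _).trans (norm_conj_div_norm_mul_le (f x) (g x))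
  have hint : ∫ x, (u x * g x).re ∂μ = ∫ x, ‖g x‖ ∂μ := by
    rw [← L1.norm_eq_integral_norm, ← Complex.ofReal_re ‖g‖, ← h, signFunctional_apply]
    exact integral_re hug
  filter_upwards [(integral_eq_iff_of_ae_le hug.re hg.norm (ae_of_all μ hle)).1 hint] with x hx
  have hre : (u x * g x).re = ‖u x * g x‖ := (Complex.re_le_norm _).antisymm
    ((norm_conj_div_norm_mul_le (f x) (g x)).trans hx.ge)
  have hconj : conj (f x) = u x * (‖f x‖ : ℂ) :=
    (div_mul_cancel_of_imp fun h0 => by simpa using h0).symm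
  calc (0 : ℂ) ≤ (‖f x‖ : ℂ) * (u x * g x) :=
        mul_nonneg (by exact_mod_cast norm_nonneg (f x)) (Complex.re_eq_norm.1 hre)
    _ = g x * conj (f x) := by rw [hconj]; ring

end SignFunctional

section Exposed

variable {p q : ℂ[X]}

theorem isExposedPointOfBall_of_forall_exists_smul {E : Type*} [NormedAddCommGroup E]
    [NormedSpace ℂ E] {ξ : E} (hξ : ‖ξ‖ = 1) {φ : E →L[ℂ] ℂ} (hφ : ‖φ‖ ≤ 1) (hφξ : φ ξ = 1)
    (h : ∀ x, ‖x‖ ≤ 1 → φ x = 1 → ∃ c : ℂ, x = c • ξ) : IsExposedPointOfBall ξ := by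
  have hφ_ge : 1 ≤ ‖φ‖ := by simpa [hφξ, hξ] using φ.le_opNorm ξ
  refine ⟨mem_closedBall_zero_iff.2 hξ.le, φ, hφ.antisymm hφ_ge, Set.Subset.antisymm ?_ ?_⟩
  · rintro x ⟨hx, hφx⟩
    obtain ⟨c, rfl⟩ := h x (mem_closedBall_zero_iff.1 hx) hφx
    have hc : c = 1 := by simpa [hφξ] using hφx
    rw [hc, one_smul, Set.mem_singleton_iff]
  · rintro _ rfl
    exact ⟨mem_closedBall_zero_iff.2 hξ.le, hφξ⟩

theorem coeFn_toL1 (p : ℂ[X]) : toL1 p =ᵐ[AddCircle.haarAddCircle] onCircle p :=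
  ContinuousMap.coeFn_toLp AddCircle.haarAddCircle (onCircle p)

theorem forall_circle_nonneg_of_signFunctional_eq_norm
    (h : signFunctional (toL1 p) (toL1 q) = ‖toL1 q‖) (z : Circle) :
    0 ≤ q.eval (z : ℂ) * conj (p.eval (z : ℂ)) := by
  have hae : ∀ᵐ t ∂AddCircle.haarAddCircle, 0 ≤ onCircle q t * conj (onCircle p t) := by
    filter_upwards [ae_nonneg_mul_conj_of_signFunctional_eq_norm h, coeFn_toL1 p, coeFn_toL1 q]
      with t ht hp hq
    rwa [hp, hq] at ht
  have hclosed : IsClosed {t | 0 ≤ onCircle q t * conj (onCircle p t)} :=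
    isClosed_le continuous_const (by fun_prop)
  have hall : {t | 0 ≤ onCircle q t * conj (onCircle p t)} = Set.univ :=
    hclosed.closure_eq.symm.trans (Measure.dense_of_ae hae).closure_eq
  obtain ⟨t, rfl⟩ := (AddCircle.homeomorphCircle Real.two_pi_pos.ne').surjective z
  rw [AddCircle.homeomorphCircle_apply]
  exact hall.ge (Set.mem_univ t)

theorem isExposedPointOfBall_of_forall_circle_nonneg (V : Submodule ℂ ℂ[X]) (hp : p ∈ V)
    (hnorm : ‖toL1 p‖ = 1)
    (h : ∀ q ∈ V, (∀ z : Circle, 0 ≤ q.eval (z : ℂ) * conj (p.eval (z : ℂ))) → ∃ c : ℂ, q = c • p) :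
    IsExposedPointOfBall (⟨toL1 p, Submodule.mem_map_of_mem hp⟩ : V.map toL1) := by
  let φ : V.map toL1 →L[ℂ] ℂ := (signFunctional (toL1 p)).comp (Submodule.subtypeL _)
  have hφ_le (x : V.map toL1) : ‖φ x‖ ≤ ‖x‖ := by
    rw [← one_mul ‖x‖]
    exact (signFunctional (toL1 p)).le_of_opNorm_le (norm_signFunctional_le_one _) x
  have hφp : φ ⟨toL1 p, Submodule.mem_map_of_mem hp⟩ = 1 :=
    (signFunctional_self (toL1 p)).trans (by rw [hnorm, Complex.ofReal_one])
  refine isExposedPointOfBall_of_forall_exists_smul hnorm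
    (φ.opNorm_le_bound zero_le_one fun x => by simpa using hφ_le x) hφp ?_
  rintro ⟨_, q, hq, rfl⟩ hq_le hφq
  have hq_norm : ‖toL1 q‖ = 1 := by
    refine le_antisymm hq_le ?_
    simpa [hφq] using hφ_le ⟨toL1 q, q, hq, rfl⟩
  obtain ⟨c, rfl⟩ := h q hq (forall_circle_nonneg_of_signFunctional_eq_norm
    (by rw [hq_norm]; exact_mod_cast hφq))
  exact ⟨c, Subtype.ext (map_smul toL1 c p)⟩

end Exposed

end Fewnomial

end

theorem corollary3p2_general (N : ℕ) {M : ℕ} (k : Fin M → ℕ) (p : Polynomial ℂ)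
    (hp : p ∈ Fewnomial.lacunary (Fewnomial.admissible N k))
    (hnorm : ‖Fewnomial.toL1 p‖ = 1)
    (hrank : (Fewnomial.MTilde N k p).rank = 2 * Fewnomial.mTilde N p) :
    Fewnomial.IsExposedPointOfBall
      (⟨Fewnomial.toL1 p, Submodule.mem_map_of_mem hp⟩ :
        Fewnomial.lacunaryL1 (Fewnomial.admissible N k)) := by
  have hp0 : p ≠ 0 := by
    rintro rfl
    simp at hnorm
  refine Fewnomial.isExposedPointOfBall_of_forall_circle_nonneg _ hp hnorm fun q hq hqp => ?_
  obtain ⟨c, rfl⟩ := Fewnomial.exists_eq_smul_of_rank_MTilde hp hp0 hrank hq hqp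
  exact ⟨c, (Complex.coe_smul c p).symm⟩

theorem corollary3p2 (N M : ℕ) (hN : 0 < N) (k : Fin M → ℕ) (hk : StrictMono k)
    (hk_pos : ∀ j, 0 < k j) (hk_lt : ∀ j, k j < N)
    (p : Polynomial ℂ) (hp : p ∈ Fewnomial.lacunary (Fewnomial.admissible N k))
    (hnorm : ‖Fewnomial.toL1 p‖ = 1)
    (hrank : (Fewnomial.MTilde N k p).rank = 2 * Fewnomial.mTilde N p) :
    Fewnomial.IsExposedPointOfBall
      (⟨Fewnomial.toL1 p, Submodule.mem_map_of_mem hp⟩ :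
        Fewnomial.lacunaryL1 (Fewnomial.admissible N k)) :=
  corollary3p2_general N k p hp hnorm hrank
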